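/- Let $J\subset\mathbb{R}^2$ be a Jordan curve. For $p\in\mathbb{R}^2\setminus J$ let $s_p$ be the maximal open vertical segment (possibly of infinite length) through $p$ that does not meet $J$. Call $s_p$ and $s_q$ equivalent if they can be joined by a finite chain of such open segments in which any two consecutive ones are joined by a horizontal segment disjoint from $J$; write $[s_p]$ for the equivalence class. Let $p^*\in\mathbb{R}^2\setminus J$ be such that $[s_{p^*}]$ contains no open segment of infinite length. For a horizontal segment $t$ whose interior does not meet $J$, the horizontal sweep $H(t)$ is the set of all $s_p$ with $p\in t\setminus J$; the union of these segments is the region swept by $H(t)$. If $K$ is the boundary of such a region, or of a finite union of such regions, let $\mathcal{V}(K)$ be the set of vertical segments of positive length whose interior lies in $K\setminus J$ and whose two endpoints lie on $J$. The greedy sweepline algorithm $\mathcal{S}_{greedy}$ runs as follows. Let $t_1$ be a horizontal segment with both endpoints on $J$, with interior disjoint from $J$ and with $p^*$ in its interior. For $i=1,2,\dots$, let $E_i$ be the union of the regions swept by $H(t_1),\dots,H(t_i)$, let $K_i$ be the boundary of $E_i$, and let $\mathrm{ext}(K_i)=\mathbb{R}^2\setminus \overline{E_i}$. If $\mathcal{V}(K_i)=\emptyset$,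 halt. Otherwise let $u_i\in\mathcal{V}(K_i)$ be of maximum length (ties broken arbitrarily), let $m_i$ be its midpoint, and let $t_{i+1}$ be a horizontal segment with one endpoint $m_i$ and the other endpoint on $J$, with interior disjoint from $J$ and with $t_{i+1}\setminus\{m_i\}\subset\mathrm{ext}(K_i)$. The recursion tree $T(\mathcal{S}_{greedy})$ has the sweeps $H(t_1),H(t_2),\dots$ of the run as nodes and $H(t_1)$ as root; $H(t_{i+1})$ is a child of the sweep $H(t_j)$, $j\le i$, with $u_i\in\mathcal{V}(\partial H(t_j))$, where $\partial H(t_j)$ is the boundary of the region swept by $H(t_j)$. An infinite ray starting at the root is an infinite sequence $r=(H(t_{i_1}),H(t_{i_2}),\dots)$ with $i_1=1$ in which each term after the first is a child of the preceding one. A limiting segment of $r$ is a (possibly degenerate) vertical segment that is the limit, in the sense of convergence of both endpoints, of open segments $s_k\in H(t_{i_{n_k}})$ for some $n_1<n_2<\cdots$. The ray $r$ is non-terminating if it has a limiting segment of positive length. Then, for every run of $\mathcal{S}_{greedy}$, the recursion tree $T(\mathcal{S}_{greedy})$ has no non-terminating infinite ray starting at the root. -/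

import Mathlib

open Set Filter Topology

namespace Sweep

/-- A Jordan curve in the plane: the image of the circle under a continuous injective map. -/
def IsJordanCurve (J : Set (ℝ × ℝ)) : Prop :=
  ∃ γ : Circle → ℝ × ℝ, Continuous γ ∧ Function.Injective γ ∧ range γ = J

/-- The open segment `s_p`: for `p ∉ J`, the maximal open vertical segment (possibly infinite)
through `p` that does not meet `J`. -/
def openSeg (J : Set (ℝ × ℝ)) (p : ℝ × ℝ) : Set (ℝ × ℝ) :=
  {q | q.1 = p.1 ∧ Disjoint (segment ℝ p q) J}

/-- Two open segments are directly linked if some horizontal segment (possibly a point) that avoids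
`J` joins a point of the one to a point of the other. -/
def Linked (J : Set (ℝ × ℝ)) (s s' : Set (ℝ × ℝ)) : Prop :=
  ∃ p q : ℝ × ℝ, p.2 = q.2 ∧ Disjoint (segment ℝ p q) J ∧ s = openSeg J p ∧ s' = openSeg J q

/-- The equivalence class `[s_p]` of open segments. -/
def segClass (J : Set (ℝ × ℝ)) (p : ℝ × ℝ) : Set (Set (ℝ × ℝ)) :=
  {s | Relation.EqvGen (Linked J) (openSeg J p) s}

/-- A nondegenerate horizontal segment, given by its two endpoints. -/
structure HSeg where
  src : ℝ × ℝ
  tgt : ℝ × ℝ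
  horizontal : src.2 = tgt.2
  nondegenerate : src ≠ tgt

namespace HSeg

/-- The closed segment as a set of points. -/
def carrier (t : HSeg) : Set (ℝ × ℝ) := segment ℝ t.src t.tgt

/-- The segment without its endpoints. -/
def interior (t : HSeg) : Set (ℝ × ℝ) := openSegment ℝ t.src t.tgt

end HSeg

/-- A vertical segment of finite length, possibly degenerate (a point). -/
structure VSeg where
  x : ℝ
  lo : ℝ
  hi : ℝ
  lo_le_hi : lo ≤ hi

namespace VSeg

/-- The segment without its endpoints. -/
def interior (s : VSeg) : Set (ℝ × ℝ) := {s.x} ×ˢ Ioo s.lo s.hi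

def length (s : VSeg) : ℝ := s.hi - s.lo

noncomputable def midpoint (s : VSeg) : ℝ × ℝ := (s.x, (s.lo + s.hi) / 2)

end VSeg

/-- The horizontal sweep `H(t)`: the set of all open segments through points of `t` off `J`. -/
def sweep (J : Set (ℝ × ℝ)) (t : HSeg) : Set (Set (ℝ × ℝ)) :=
  {s | ∃ p ∈ t.carrier, p ∉ J ∧ s = openSeg J p}

/-- The region swept by `H(t)`. -/
def sweepRegion (J : Set (ℝ × ℝ)) (t : HSeg) : Set (ℝ × ℝ) := ⋃₀ sweep J t

/-- `𝒱(K)`: the vertical segments of positive length that lie on the curve `K`, with both endpoints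
on `J` and with no other point on `J`. -/
def verticals (J K : Set (ℝ × ℝ)) : Set VSeg :=
  {s | s.lo < s.hi ∧ s.interior ⊆ K ∧ Disjoint s.interior J ∧ (s.x, s.lo) ∈ J ∧ (s.x, s.hi) ∈ J}

/-- The region swept by `H(t 0), …, H(t i)`. -/
def swept (J : Set (ℝ × ℝ)) (t : ℕ → HSeg) (i : ℕ) : Set (ℝ × ℝ) :=
  ⋃ j ≤ i, sweepRegion J (t j)

/-- The curve `K_i` that bounds the region swept by `H(t 0), …, H(t i)`. -/
def sweptBoundary (J : Set (ℝ × ℝ)) (t : ℕ → HSeg) (i : ℕ) : Set (ℝ × ℝ) :=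
  frontier (swept J t i)

/-- `ext(K_i)`: everything outside the closed region that `K_i` bounds. -/
def sweptExterior (J : Set (ℝ × ℝ)) (t : ℕ → HSeg) (i : ℕ) : Set (ℝ × ℝ) :=
  (closure (swept J t i))ᶜ

/-- A complete run of the greedy sweepline algorithm on `J` from the point `pstar`. Indices start
at `0`. The number `steps` of extensions is infinite if the algorithm does not halt; the horizontal
segments constructed are the `t i` with `i ≤ steps`, and `u i`, for `i < steps`, is the vertical
segment chosen for the extension by `t (i + 1)`. Other values of `t` and `u` are irrelevant. -/
structure GreedyRun (J : Set (ℝ × ℝ)) (pstar : ℝ × ℝ) where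
  steps : ℕ∞
  t : ℕ → HSeg
  u : ℕ → VSeg
  pstar_mem : pstar ∈ (t 0).interior
  first_interior : Disjoint (t 0).interior J
  first_src : (t 0).src ∈ J
  first_tgt : (t 0).tgt ∈ J
  halt : ∀ n : ℕ, steps = n → verticals J (sweptBoundary J t n) = ∅
  choice : ∀ i : ℕ, (i : ℕ∞) < steps → u i ∈ verticals J (sweptBoundary J t i)
  greedy : ∀ i : ℕ, (i : ℕ∞) < steps →
    ∀ v ∈ verticals J (sweptBoundary J t i), v.length ≤ (u i).length
  next_src : ∀ i : ℕ, (i : ℕ∞) < steps → (t (i + 1)).src = (u i).midpoint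
  next_tgt : ∀ i : ℕ, (i : ℕ∞) < steps → (t (i + 1)).tgt ∈ J
  next_interior : ∀ i : ℕ, (i : ℕ∞) < steps → Disjoint (t (i + 1)).interior J
  next_exterior : ∀ i : ℕ, (i : ℕ∞) < steps →
    (t (i + 1)).carrier \ {(u i).midpoint} ⊆ sweptExterior J t i

namespace GreedyRun

variable {J : Set (ℝ × ℝ)} {pstar : ℝ × ℝ}

/-- The nodes of the recursion tree; node `i` is the horizontal sweep `H(t i)`. -/
def Node (R : GreedyRun J pstar) : Type := {i : ℕ // (i : ℕ∞) ≤ R.steps}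

/-- The root of the recursion tree is the initial horizontal sweep. -/
def root (R : GreedyRun J pstar) : R.Node := ⟨0, by simp⟩

/-- The edges of the recursion tree, directed from parent to child: the sweep `H(t (i + 1))` is a
child of the earlier sweep `H(t a)` whose boundary contains the chosen vertical segment `u i`. -/
def IsChild (R : GreedyRun J pstar) (a b : R.Node) : Prop :=
  ∃ i : ℕ, b.1 = i + 1 ∧ a.1 ≤ i ∧ R.u i ∈ verticals J (frontier (sweepRegion J (R.t a.1)))

/-- An infinite ray of the recursion tree that starts at the root. -/
def IsRootRay (R : GreedyRun J pstar) (r : ℕ → R.Node) : Prop :=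
  r 0 = R.root ∧ ∀ k, R.IsChild (r k) (r (k + 1))

/-- `s` is a limiting segment of `r`: a limit of open segments taken from the sweeps
`H(t (r (φ 0))), H(t (r (φ 1))), …` along a subsequence of the ray. -/
def IsLimitingSegment (R : GreedyRun J pstar) (r : ℕ → R.Node) (s : VSeg) : Prop :=
  ∃ φ : ℕ → ℕ, StrictMono φ ∧ ∃ σ : ℕ → VSeg,
    (∀ k, (σ k).interior ∈ sweep J (R.t (r (φ k)).1)) ∧
    Tendsto (fun k => (σ k).x) atTop (𝓝 s.x) ∧
    Tendsto (fun k => (σ k).lo) atTop (𝓝 s.lo) ∧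
    Tendsto (fun k => (σ k).hi) atTop (𝓝 s.hi)

/-- A ray is non-terminating if it has a limiting segment of positive length. -/
def NonTerminating (R : GreedyRun J pstar) (r : ℕ → R.Node) : Prop :=
  ∃ s : VSeg, R.IsLimitingSegment r s ∧ 0 < s.length

end GreedyRun

end Sweep

namespace Sweep

/-! ### Horizontal and vertical segments -/

/-! Along a ray, each new sweep starts at the midpoint of a vertical cross-cut `v n` of `J` on the
boundary of the previous sweep, and leaves the region swept so far. The proof has two pillars.

Separation (`SweepRay.not_reach`): off `J ∪ v n`, no rectilinear path joins the sweeps up to `T n`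
to a later one. The sweeps on each side form a connected chain, since the `v n` are distinct
(`SweepRay.v_injective`), and connectedness of `J` forbids a path around a cross-cut
(`IsCrosscut.not_reach`). The latter is a crossing-parity argument with integer-valued functions
that are locally constant along `J`.

Clear half-squares (`exists_half_square`): if cross-cuts converge from one side to a segment of
positive length, continuity of a parametrisation keeps `J` away from that side of each interior
point of the limit.

Suppose a ray has a limiting segment of positive length. If the approximating segments eventually
lie on the limiting vertical line, they are eventually all equal, and one open segment lies in three
sweeps, which `false_of_mem_three` excludes. Otherwise a subsequence approaches from one side. In
the half-square its members are joined by horizontal segments off `J`, which by separation every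
late `v n` must cross; so the `v n` themselves accumulate there (`false_of_sweeps`). But a
horizontal segment that starts at such a `v n` either runs towards the limit through later
cross-cuts, or runs away and leaves later sweeps on the wrong side of `v n` (`false_of_tendsto`). -/

theorem mem_segment_of_snd_eq {p q z : ℝ × ℝ} (h : p.2 = q.2) :
    z ∈ segment ℝ p q ↔ z.1 ∈ uIcc p.1 q.1 ∧ z.2 = p.2 := by
  obtain ⟨a, b⟩ := p
  obtain ⟨c, d⟩ := q
  obtain ⟨x, y⟩ := z
  obtain rfl : b = d := h
  rw [← Prod.image_mk_segment_left, segment_eq_uIcc]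
  simp only [mem_image, Prod.mk.injEq]
  grind

theorem mem_segment_of_fst_eq {p q z : ℝ × ℝ} (h : p.1 = q.1) :
    z ∈ segment ℝ p q ↔ z.1 = p.1 ∧ z.2 ∈ uIcc p.2 q.2 := by
  obtain ⟨a, b⟩ := p
  obtain ⟨c, d⟩ := q
  obtain ⟨x, y⟩ := z
  obtain rfl : a = c := h
  rw [← Prod.image_mk_segment_right, segment_eq_uIcc]
  simp only [mem_image, Prod.mk.injEq]
  grind

theorem mem_openSeg_iff {J : Set (ℝ × ℝ)} {p z : ℝ × ℝ} :
    z ∈ openSeg J p ↔ z.1 = p.1 ∧ ∀ y ∈ uIcc p.2 z.2, (p.1, y) ∉ J := by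
  unfold openSeg
  refine and_congr_right fun h => ?_
  rw [Set.disjoint_left]
  constructor
  · intro H y hy
    exact H ((mem_segment_of_fst_eq h.symm).2 ⟨rfl, hy⟩)
  · intro H w hw
    obtain ⟨h1, h2⟩ := (mem_segment_of_fst_eq h.symm).1 hw
    have := H _ h2
    rwa [← h1] at this

theorem mem_openSeg_self {J : Set (ℝ × ℝ)} {p : ℝ × ℝ} (hp : p ∉ J) : p ∈ openSeg J p := by
  rw [mem_openSeg_iff]
  refine ⟨rfl, fun y hy => ?_⟩
  obtain rfl : y = p.2 := by simpa using hy
  exact hp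

theorem disjoint_openSeg {J : Set (ℝ × ℝ)} (p : ℝ × ℝ) : Disjoint (openSeg J p) J := by
  rw [Set.disjoint_left]
  intro z hz
  have h := mem_openSeg_iff.1 hz
  have := h.2 z.2 right_mem_uIcc
  rwa [← h.1] at this

theorem openSeg_trans {J : Set (ℝ × ℝ)} {p z w : ℝ × ℝ} (hz : z ∈ openSeg J p)
    (hw : w ∈ openSeg J z) : w ∈ openSeg J p := by
  rw [mem_openSeg_iff] at *
  refine ⟨hw.1.trans hz.1, fun y hy => ?_⟩
  rcases uIcc_subset_uIcc_union_uIcc (b := z.2) hy with h | h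
  · exact hz.2 y h
  · rw [← hz.1]
    exact hw.2 y h

theorem HSeg.mem_carrier_iff {t : HSeg} {z : ℝ × ℝ} :
    z ∈ t.carrier ↔ z.1 ∈ uIcc t.src.1 t.tgt.1 ∧ z.2 = t.src.2 :=
  mem_segment_of_snd_eq t.horizontal

theorem HSeg.mem_interior_iff {t : HSeg} {z : ℝ × ℝ} :
    z ∈ t.interior ↔ z ∈ t.carrier ∧ z ≠ t.src ∧ z ≠ t.tgt := by
  constructor
  · intro h
    refine ⟨openSegment_subset_segment _ _ _ h, ?_, ?_⟩
    · rintro rfl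
      exact t.nondegenerate (left_mem_openSegment_iff.1 h)
    · rintro rfl
      exact t.nondegenerate (right_mem_openSegment_iff.1 h)
  · rintro ⟨h, h1, h2⟩
    exact mem_openSegment_of_ne_left_right h1.symm h2.symm h

theorem HSeg.fst_ne (t : HSeg) : t.tgt.1 - t.src.1 ≠ 0 := by
  intro h
  exact t.nondegenerate (Prod.ext (by linarith) t.horizontal)

theorem HSeg.interior_subset_carrier (t : HSeg) : t.interior ⊆ t.carrier :=
  openSegment_subset_segment _ _ _

theorem HSeg.src_mem_carrier (t : HSeg) : t.src ∈ t.carrier := left_mem_segment _ _ _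

theorem HSeg.mem_interior_of_mul_pos {t : HSeg} {z : ℝ × ℝ} (h2 : z.2 = t.src.2)
    (hpos : 0 < (z.1 - t.src.1) * (t.tgt.1 - t.src.1))
    (hlt : |z.1 - t.src.1| < |t.tgt.1 - t.src.1|) : z ∈ t.interior := by
  rw [HSeg.mem_interior_iff, HSeg.mem_carrier_iff]
  refine ⟨⟨?_, h2⟩, ?_, ?_⟩
  · rw [mem_uIcc]
    rcases mul_pos_iff.1 hpos with ⟨a, b⟩ | ⟨a, b⟩
    · rw [abs_of_pos a, abs_of_pos b] at hlt
      left; constructor <;> linarith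
    · rw [abs_of_neg a, abs_of_neg b] at hlt
      right; constructor <;> linarith
  · rintro rfl
    simp at hpos
  · rintro rfl
    exact lt_irrefl _ hlt

theorem HSeg.mem_interior_iff_fst {t : HSeg} {z : ℝ × ℝ} :
    z ∈ t.interior ↔ z.2 = t.src.2 ∧ z.1 ∈ Ioo (min t.src.1 t.tgt.1) (max t.src.1 t.tgt.1) := by
  rw [HSeg.mem_interior_iff, HSeg.mem_carrier_iff]
  have h1 : z ≠ t.src ↔ ¬ (z.1 = t.src.1 ∧ z.2 = t.src.2) := by rw [Ne, Prod.ext_iff]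
  have h2 : z ≠ t.tgt ↔ ¬ (z.1 = t.tgt.1 ∧ z.2 = t.src.2) := by
    rw [Ne, Prod.ext_iff, t.horizontal]
  rw [h1, h2, uIcc, mem_Icc, mem_Ioo]
  constructor
  · rintro ⟨⟨⟨a, b⟩, c⟩, d, e⟩
    refine ⟨c, lt_of_le_of_ne a ?_, lt_of_le_of_ne b ?_⟩ <;> grind
  · rintro ⟨c, a, b⟩
    refine ⟨⟨⟨a.le, b.le⟩, c⟩, ?_, ?_⟩ <;> grind

theorem HSeg.disjoint_segment {J : Set (ℝ × ℝ)} {t : HSeg} (ht : Disjoint t.interior J)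
    {p q : ℝ × ℝ} (hp : p ∈ t.carrier) (hq : q ∈ t.carrier) (hpJ : p ∉ J) (hqJ : q ∉ J) :
    Disjoint (segment ℝ p q) J := by
  rw [Set.disjoint_left]
  intro z hz hzJ
  have hzt : z ∈ t.carrier := (convex_segment t.src t.tgt).segment_subset hp hq hz
  have hp' := HSeg.mem_carrier_iff.1 hp
  have hq' := HSeg.mem_carrier_iff.1 hq
  have hz' := (mem_segment_of_snd_eq (hp'.2.trans hq'.2.symm)).1 hz
  have hzp : z.1 ≠ p.1 := fun h => hpJ ((Prod.ext h hz'.2 : z = p) ▸ hzJ)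
  have hzq : z.1 ≠ q.1 := fun h =>
    hqJ ((Prod.ext h (hz'.2.trans (hp'.2.trans hq'.2.symm)) : z = q) ▸ hzJ)
  refine Set.disjoint_left.1 ht (HSeg.mem_interior_iff_fst.2 ⟨hz'.2.trans hp'.2, ?_⟩) hzJ
  have h1 := hz'.1
  have h2 := hp'.1
  have h3 := hq'.1
  rw [uIcc, mem_Icc] at h1 h2 h3
  grind

/-! ### Vertical cross-cuts -/

/-- A vertical segment of positive length that meets `J` exactly in its two endpoints. -/
structure IsCrosscut (J : Set (ℝ × ℝ)) (v : VSeg) : Prop where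
  lt : v.lo < v.hi
  disj : Disjoint v.interior J
  lo_mem : (v.x, v.lo) ∈ J
  hi_mem : (v.x, v.hi) ∈ J

theorem VSeg.mem_interior_iff {v : VSeg} {z : ℝ × ℝ} :
    z ∈ v.interior ↔ z.1 = v.x ∧ v.lo < z.2 ∧ z.2 < v.hi := by
  simp [VSeg.interior, mem_prod]

namespace IsCrosscut

variable {J : Set (ℝ × ℝ)} {v w : VSeg}

theorem midpoint_mem (h : IsCrosscut J v) : v.midpoint ∈ v.interior := by
  rw [VSeg.mem_interior_iff]
  have := h.lt
  refine ⟨rfl, ?_, ?_⟩ <;> simp only [VSeg.midpoint] <;> linarith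

theorem notMem (h : IsCrosscut J v) {z : ℝ × ℝ} (hz : z ∈ v.interior) : z ∉ J :=
  Set.disjoint_left.1 h.disj hz

theorem mem_openSeg (h : IsCrosscut J v) {p z : ℝ × ℝ} (hp : p ∈ v.interior)
    (hz : z ∈ v.interior) : z ∈ openSeg J p := by
  rw [VSeg.mem_interior_iff] at hp hz
  rw [mem_openSeg_iff]
  refine ⟨hz.1.trans hp.1.symm, fun y hy => h.notMem (VSeg.mem_interior_iff.2 ⟨hp.1, ?_⟩)⟩
  rw [uIcc, mem_Icc] at hy
  grind

theorem mem_of_openSeg (h : IsCrosscut J v) {p z : ℝ × ℝ} (hz : z ∈ openSeg J p)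
    (hzv : z ∈ v.interior) : p ∈ v.interior := by
  rw [VSeg.mem_interior_iff] at hzv ⊢
  rw [mem_openSeg_iff] at hz
  have hx : p.1 = v.x := hz.1.symm.trans hzv.1
  refine ⟨hx, ?_, ?_⟩
  · by_contra hc
    refine hz.2 v.lo ?_ (hx ▸ h.lo_mem)
    rw [mem_uIcc]; left; constructor <;> linarith [hzv.2.1]
  · by_contra hc
    refine hz.2 v.hi ?_ (hx ▸ h.hi_mem)
    rw [mem_uIcc]; right; constructor <;> linarith [hzv.2.2]

/-- An endpoint of one cross-cut lies on `J`, so it cannot be interior to the other. -/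
theorem eq_of_mem (hv : IsCrosscut J v) (hw : IsCrosscut J w) {z : ℝ × ℝ}
    (hzv : z ∈ v.interior) (hzw : z ∈ w.interior) : v = w := by
  have key : ∀ {v w : VSeg}, IsCrosscut J v → IsCrosscut J w → z ∈ v.interior →
      z ∈ w.interior → w.lo ≤ v.lo ∧ v.hi ≤ w.hi := by
    intro v w hv hw hzv hzw
    rw [VSeg.mem_interior_iff] at hzv hzw
    have hx : w.x = v.x := hzw.1.symm.trans hzv.1
    constructor <;> by_contra hc
    · refine hv.notMem (z := (w.x, w.lo)) (VSeg.mem_interior_iff.2 ⟨hx, ?_, ?_⟩) hw.lo_mem <;>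
        simp only <;> linarith
    · refine hv.notMem (z := (w.x, w.hi)) (VSeg.mem_interior_iff.2 ⟨hx, ?_, ?_⟩) hw.hi_mem <;>
        simp only <;> linarith
  have h1 := key hv hw hzv hzw
  have h2 := key hw hv hzw hzv
  have hx : v.x = w.x :=
    (VSeg.mem_interior_iff.1 hzv).1.symm.trans (VSeg.mem_interior_iff.1 hzw).1
  obtain ⟨vx, vl, vh, hvl⟩ := v
  obtain ⟨wx, wl, wh, hwl⟩ := w
  simp only [VSeg.mk.injEq] at *
  refine ⟨hx, ?_, ?_⟩ <;> linarith

theorem isClosed_union (hJ : IsClosed J) (h : IsCrosscut J v) : IsClosed (J ∪ v.interior) := by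
  have : J ∪ v.interior = J ∪ {v.x} ×ˢ Icc v.lo v.hi := by
    ext ⟨a, b⟩
    simp only [mem_union, VSeg.mem_interior_iff, mem_prod, mem_singleton_iff, mem_Icc]
    constructor
    · rintro (h | ⟨h1, h2, h3⟩)
      · exact Or.inl h
      · exact Or.inr ⟨h1, h2.le, h3.le⟩
    · rintro (h' | ⟨h1, h2, h3⟩)
      · exact Or.inl h'
      · subst h1
        rcases h2.eq_or_lt with rfl | h2
        · exact Or.inl h.lo_mem
        rcases h3.eq_or_lt with rfl | h3
        · exact Or.inl h.hi_mem
        exact Or.inr ⟨rfl, h2, h3⟩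
  rw [this]
  exact hJ.union (isClosed_singleton.prod isClosed_Icc)

end IsCrosscut

/-- An endpoint off `J` would itself belong to the maximal segment. -/
theorem isCrosscut_of_interior_eq_openSeg {J : Set (ℝ × ℝ)} {v : VSeg} {p : ℝ × ℝ}
    (hp : p ∉ J) (h : v.interior = openSeg J p) : IsCrosscut J v := by
  have hpv : p ∈ v.interior := h ▸ mem_openSeg_self hp
  obtain ⟨h1, h2, h3⟩ := VSeg.mem_interior_iff.1 hpv
  have hd : Disjoint v.interior J := h ▸ disjoint_openSeg p
  refine ⟨h2.trans h3, hd, ?_, ?_⟩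
  · by_contra hc
    have : (v.x, v.lo) ∈ v.interior := by
      rw [h, mem_openSeg_iff]
      refine ⟨h1.symm, fun y hy => ?_⟩
      rw [uIcc_of_ge h2.le, mem_Icc] at hy
      rw [h1]
      rcases hy.1.eq_or_lt with h4 | h4
      · exact h4 ▸ hc
      · exact Set.disjoint_left.1 hd (VSeg.mem_interior_iff.2 ⟨rfl, h4, hy.2.trans_lt h3⟩)
    exact lt_irrefl _ (VSeg.mem_interior_iff.1 this).2.1
  · by_contra hc
    have : (v.x, v.hi) ∈ v.interior := by
      rw [h, mem_openSeg_iff]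
      refine ⟨h1.symm, fun y hy => ?_⟩
      rw [uIcc_of_le h3.le, mem_Icc] at hy
      rw [h1]
      rcases hy.2.eq_or_lt with h4 | h4
      · exact h4 ▸ hc
      · exact Set.disjoint_left.1 hd (VSeg.mem_interior_iff.2 ⟨rfl, h2.trans_le hy.1, h4⟩)
    exact lt_irrefl _ (VSeg.mem_interior_iff.1 this).2.2

/-! ### Rectilinear paths and separation by cross-cuts -/

/-- `p` and `q` are joined by a path of horizontal and vertical segments that avoids `F`. -/
def Reach (F : Set (ℝ × ℝ)) : ℝ × ℝ → ℝ × ℝ → Prop :=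
  Relation.ReflTransGen fun p q => (p.1 = q.1 ∨ p.2 = q.2) ∧ Disjoint (segment ℝ p q) F

theorem Reach.trans {F : Set (ℝ × ℝ)} {p q r : ℝ × ℝ} (h : Reach F p q) (h' : Reach F q r) :
    Reach F p r := Relation.ReflTransGen.trans h h'

theorem Reach.symm {F : Set (ℝ × ℝ)} {p q : ℝ × ℝ} (h : Reach F p q) : Reach F q p := by
  induction h with
  | refl => exact Relation.ReflTransGen.refl
  | @tail b c _ hs ih =>
    exact Relation.ReflTransGen.head ⟨hs.1.imp Eq.symm Eq.symm, segment_symm ℝ b c ▸ hs.2⟩ ih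

theorem Reach.of_horizontal {F : Set (ℝ × ℝ)} {p q : ℝ × ℝ} (h : p.2 = q.2)
    (hd : Disjoint (segment ℝ p q) F) : Reach F p q :=
  Relation.ReflTransGen.single ⟨Or.inr h, hd⟩

theorem Reach.of_vertical {F : Set (ℝ × ℝ)} {p q : ℝ × ℝ} (h : p.1 = q.1)
    (hd : Disjoint (segment ℝ p q) F) : Reach F p q :=
  Relation.ReflTransGen.single ⟨Or.inl h, hd⟩

/-- The indicator of the quadrant of points to the right of `p` and below `p`. -/
noncomputable def quadrant (p z : ℝ × ℝ) : ℤ := if z.2 < p.2 ∧ p.1 ≤ z.1 then 1 else 0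

/-- The difference is the signed indicator of the half-strip below the segment. Its value changes
under vertical motion only across the segment itself. -/
theorem eventually_quadrant_sub_eq {q r z : ℝ × ℝ} (hh : q.2 = r.2) (hzs : z ∉ segment ℝ q r) :
    ∀ᶠ z' in 𝓝 z, quadrant q z' - quadrant r z' =
      quadrant q (z'.1, z.2) - quadrant r (z'.1, z.2) := by
  rcases lt_trichotomy z.2 q.2 with hlt | heq | hgt
  · filter_upwards [continuous_snd.continuousAt.eventually_lt_const hlt] with z' hz'
    simp only [quadrant]
    grind
  · rw [mem_segment_of_snd_eq hh] at hzs
    have hx : z.1 ∉ uIcc q.1 r.1 := fun hc => hzs ⟨hc, heq⟩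
    have : ∀ᶠ z' in 𝓝 z, z'.1 ∉ uIcc q.1 r.1 :=
      continuous_fst.continuousAt.eventually
        (isClosed_Icc.isOpen_compl.mem_nhds hx)
    filter_upwards [this] with z' hz'
    rw [mem_uIcc] at hz'
    simp only [quadrant]
    grind
  · filter_upwards [continuous_snd.continuousAt.eventually_const_lt hgt] with z' hz'
    simp only [quadrant]
    grind

/-- The horizontal and the vertical steps of a rectilinear path off `F` contribute to
`quadrant p - quadrant q` functions `H` and `V` that, near `F`, depend only on the first and only on
the second coordinate, respectively. -/
theorem Reach.exists_crossing {F : Set (ℝ × ℝ)} {p q : ℝ × ℝ} (h : Reach F p q) :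
    ∃ H V : ℝ × ℝ → ℤ, (∀ z, H z + V z = quadrant p z - quadrant q z) ∧
      (∀ z ∈ F, ∀ᶠ z' in 𝓝 z, H z' = H (z'.1, z.2)) ∧
      (∀ z ∈ F, ∀ᶠ z' in 𝓝 z, V z' = V (z.1, z'.2)) ∧
      ∀ x lo hi, lo ≤ hi → (∀ y ∈ Icc lo hi, (x, y) ∈ F) → H (x, lo) = H (x, hi) := by
  induction h with
  | refl => exact ⟨0, 0, by simp, by simp, by simp, by simp⟩
  | @tail q r _ hstep ih =>
    obtain ⟨H, V, h1, h2, h3, h4⟩ := ih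
    obtain ⟨hxy, hd⟩ := hstep
    by_cases hh : q.2 = r.2
    -- A horizontal step contributes the half-strip below it, which goes into `H`; a vertical step
    -- contributes the half-strip to its right, which goes into `V`.
    · refine ⟨fun z => H z + (quadrant q z - quadrant r z), V, ?_, ?_, h3, ?_⟩
      · intro z
        linarith [h1 z]
      · intro z hz
        have key := eventually_quadrant_sub_eq hh fun hc => Set.disjoint_left.1 hd hc hz
        filter_upwards [key, h2 z hz] with z' ha hb
        rw [hb, ha]
      · intro x lo hi hle hF
        simp only
        rw [h4 x lo hi hle hF]
        congr 1
        by_cases hc : q.2 ∈ Icc lo hi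
        · have hzs := Set.disjoint_right.1 hd (hF _ hc)
          rw [mem_segment_of_snd_eq hh, mem_uIcc] at hzs
          simp only [quadrant]
          grind
        · simp only [quadrant]
          rw [mem_Icc] at hc
          grind
    · have hv : q.1 = r.1 := hxy.resolve_right hh
      refine ⟨H, fun z => V z + (quadrant q z - quadrant r z), ?_, h2, ?_, h4⟩
      · intro z
        linarith [h1 z]
      · intro z hz
        have key : ∀ᶠ z' in 𝓝 z, quadrant q z' - quadrant r z' =
            quadrant q (z.1, z'.2) - quadrant r (z.1, z'.2) := by
          rcases lt_trichotomy z.1 q.1 with hlt | heq | hgt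
          · filter_upwards [continuous_fst.continuousAt.eventually_lt_const hlt] with z' hz'
            simp only [quadrant]
            grind
          · have hzs : z ∉ segment ℝ q r := fun hc => Set.disjoint_left.1 hd hc hz
            rw [mem_segment_of_fst_eq hv] at hzs
            have hx : z.2 ∉ uIcc q.2 r.2 := fun hc => hzs ⟨heq, hc⟩
            have : ∀ᶠ z' in 𝓝 z, z'.2 ∉ uIcc q.2 r.2 :=
              continuous_snd.continuousAt.eventually
                (isClosed_Icc.isOpen_compl.mem_nhds hx)
            filter_upwards [this] with z' hz'
            rw [mem_uIcc] at hz'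
            simp only [quadrant]
            grind
          · filter_upwards [continuous_fst.continuousAt.eventually_const_lt hgt] with z' hz'
            simp only [quadrant]
            grind
        filter_upwards [key, h3 z hz] with z' ha hb
        rw [hb, ha]

/-- A cross-cut of a connected set `J` separates, off `J`, the two ends of a horizontal segment that
crosses it. -/
theorem IsCrosscut.not_reach_of_lt {J : Set (ℝ × ℝ)} (hJ : IsPreconnected J) {v : VSeg}
    (hv : IsCrosscut J v) {p q : ℝ × ℝ} (h2 : p.2 = q.2) (hd : Disjoint (segment ℝ p q) J)
    (hlo : v.lo < p.2) (hhi : p.2 < v.hi) (hp : p.1 < v.x) (hq : v.x < q.1) :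
    ¬ Reach (J ∪ v.interior) p q := by
  intro h
  obtain ⟨H, V, h1, hH, hV, hvert⟩ := h.exists_crossing
  -- This closes the path by the segment from `q` to `p`. Near `J`, `f` depends only on the first
  -- coordinate, while `f = -V` depends only on the second; hence `f` is locally constant along `J`.
  set f : ℝ × ℝ → ℤ := fun z => H z + (quadrant q z - quadrant p z) with hf
  have hfV : ∀ z, f z = -V z := fun z => by
    have := h1 z
    simp only [hf]
    linarith
  have hloc : ∀ z ∈ J, ∀ᶠ z' in 𝓝 z, f z' = f z := by
    intro z hz
    have hT : Tendsto (fun z' : ℝ × ℝ => (z'.1, z.2)) (𝓝 z) (𝓝 z) := by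
      have : Continuous fun z' : ℝ × ℝ => (z'.1, z.2) := by fun_prop
      exact this.tendsto' z z rfl
    have hseg : z ∉ segment ℝ q p := fun hc =>
      Set.disjoint_left.1 hd (segment_symm ℝ q p ▸ hc) hz
    filter_upwards [hH z (Or.inl hz), eventually_quadrant_sub_eq h2.symm hseg,
      hT.eventually (hV z (Or.inl hz))] with z' a b c
    have e1 : f z' = f (z'.1, z.2) := by simp only [hf]; rw [a, b]
    rw [e1, hfV, hfV, c]
  have hcont : ContinuousOn f J := fun z hz => by
    refine ContinuousAt.continuousWithinAt ?_
    rw [ContinuousAt, nhds_discrete ℤ, tendsto_pure]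
    exact hloc z hz
  have hconst : f (v.x, v.lo) = f (v.x, v.hi) := hJ.constant hcont hv.lo_mem hv.hi_mem
  have hHeq : H (v.x, v.lo) = H (v.x, v.hi) := by
    refine hvert _ _ _ hv.lt.le fun y hy => ?_
    rcases hy.1.eq_or_lt with rfl | h3
    · exact Or.inl hv.lo_mem
    rcases hy.2.eq_or_lt with rfl | h4
    · exact Or.inl hv.hi_mem
    exact Or.inr (VSeg.mem_interior_iff.2 ⟨rfl, h3, h4⟩)
  -- At the lower end of `v` only the quadrant of `p` counts, at the upper end neither does, so `f`
  -- would differ.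
  simp only [hf, hHeq, quadrant] at hconst
  grind

theorem IsCrosscut.not_reach {J : Set (ℝ × ℝ)} (hJ : IsPreconnected J) {v : VSeg}
    (hv : IsCrosscut J v) {p q : ℝ × ℝ} (h2 : p.2 = q.2) (hd : Disjoint (segment ℝ p q) J)
    (hlo : v.lo < p.2) (hhi : p.2 < v.hi) (hpq : (p.1 - v.x) * (q.1 - v.x) < 0) :
    ¬ Reach (J ∪ v.interior) p q := by
  rcases mul_neg_iff.1 hpq with ⟨h3, h4⟩ | ⟨h3, h4⟩
  · intro h
    exact hv.not_reach_of_lt hJ h2.symm (segment_symm ℝ p q ▸ hd) (h2 ▸ hlo) (h2 ▸ hhi)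
      (by linarith) (by linarith) h.symm
  · exact hv.not_reach_of_lt hJ h2 hd hlo hhi (by linarith) (by linarith)

/-! ### Rays of sweeps and their local geometry -/

/-- The horizontal segments `T n`, the vertical segments `v n` and the swept regions `E n` along a
ray of the recursion tree: `T (n + 1)` starts at the midpoint of `v n`, which lies on the boundary of
the region swept by `H(T n)` and of the region `E n` swept before `T (n + 1)` is added. -/
structure SweepRay (J : Set (ℝ × ℝ)) where
  T : ℕ → HSeg
  v : ℕ → VSeg
  E : ℕ → Set (ℝ × ℝ)
  crosscut : ∀ n, IsCrosscut J (v n)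
  frontier_E : ∀ n, (v n).interior ⊆ frontier (E n)
  frontier_T : ∀ n, (v n).interior ⊆ frontier (sweepRegion J (T n))
  subset_E : ∀ k n, k ≤ n → sweepRegion J (T k) ⊆ E n
  disjoint_interior : ∀ n, Disjoint (T n).interior J
  tgt_mem : ∀ n, (T n).tgt ∈ J
  src_zero : (T 0).src ∈ J
  src_succ : ∀ n, (T (n + 1)).src = (v n).midpoint
  exterior : ∀ n, (T (n + 1)).carrier \ {(v n).midpoint} ⊆ (closure (E n))ᶜ

theorem mem_sweepRegion_iff {J : Set (ℝ × ℝ)} {t : HSeg} {z : ℝ × ℝ} :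
    z ∈ sweepRegion J t ↔ ∃ p ∈ t.carrier, p ∉ J ∧ z ∈ openSeg J p := by
  simp only [sweepRegion, sweep, mem_sUnion, mem_ofPred_eq]
  constructor
  · rintro ⟨s, ⟨p, hp, hpJ, rfl⟩, hz⟩
    exact ⟨p, hp, hpJ, hz⟩
  · rintro ⟨p, hp, hpJ, hz⟩
    exact ⟨_, ⟨p, hp, hpJ, rfl⟩, hz⟩

theorem mem_sweepRegion_of_mem {J : Set (ℝ × ℝ)} {t : HSeg} {z : ℝ × ℝ} (hz : z ∈ t.carrier)
    (hzJ : z ∉ J) : z ∈ sweepRegion J t :=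
  mem_sweepRegion_iff.2 ⟨z, hz, hzJ, mem_openSeg_self hzJ⟩

theorem mem_sweepRegion_of_openSeg {J : Set (ℝ × ℝ)} {t : HSeg} {z w : ℝ × ℝ}
    (hz : z ∈ sweepRegion J t) (hw : w ∈ openSeg J z) : w ∈ sweepRegion J t := by
  obtain ⟨p, hp, hpJ, hzp⟩ := mem_sweepRegion_iff.1 hz
  exact mem_sweepRegion_iff.2 ⟨p, hp, hpJ, openSeg_trans hzp hw⟩

theorem disjoint_sweepRegion {J : Set (ℝ × ℝ)} {t : HSeg} : Disjoint (sweepRegion J t) J := by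
  rw [Set.disjoint_left]
  intro z hz
  obtain ⟨p, -, -, hzp⟩ := mem_sweepRegion_iff.1 hz
  exact Set.disjoint_left.1 (disjoint_openSeg p) hzp

/-- Around a point off a closed set there is a square off that set. -/
theorem exists_square {F : Set (ℝ × ℝ)} (hF : IsClosed F) {m : ℝ × ℝ} (hm : m ∉ F) :
    ∃ ρ > 0, ∀ z : ℝ × ℝ, |z.1 - m.1| < ρ → |z.2 - m.2| < ρ → z ∉ F := by
  obtain ⟨ρ, hρ, h⟩ := Metric.isOpen_iff.1 hF.isOpen_compl m hm
  refine ⟨ρ, hρ, fun z h1 h2 => h ?_⟩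
  rw [Metric.mem_ball, Prod.dist_eq, max_lt_iff, Real.dist_eq, Real.dist_eq]
  exact ⟨h1, h2⟩

theorem exists_mem_of_mem_closure {A : Set (ℝ × ℝ)} {m : ℝ × ℝ} (hm : m ∈ closure A) {ρ : ℝ}
    (hρ : 0 < ρ) : ∃ z ∈ A, |z.1 - m.1| < ρ ∧ |z.2 - m.2| < ρ := by
  obtain ⟨z, hz, hd⟩ := Metric.mem_closure_iff.1 hm ρ hρ
  rw [dist_comm, Prod.dist_eq, max_lt_iff, Real.dist_eq, Real.dist_eq] at hd
  exact ⟨z, hz, hd⟩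

theorem abs_sub_lt_of_mem_uIcc {a b c y ρ : ℝ} (h : y ∈ uIcc a b) (ha : |a - c| < ρ)
    (hb : |b - c| < ρ) : |y - c| < ρ := by
  rw [abs_lt] at *
  rw [mem_uIcc] at h
  rcases h with h | h <;> constructor <;> linarith

/-- The vertical projection of a point of a square off `J` to the horizontal line through the
centre. -/
theorem proj_mem_openSeg {J : Set (ℝ × ℝ)} {m w : ℝ × ℝ} {ρ : ℝ}
    (h : ∀ z : ℝ × ℝ, |z.1 - m.1| < ρ → |z.2 - m.2| < ρ → z ∉ J)
    (h1 : |w.1 - m.1| < ρ) (h2 : |w.2 - m.2| < ρ) : (w.1, m.2) ∈ openSeg J w := by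
  rw [mem_openSeg_iff]
  refine ⟨rfl, fun y hy => h _ h1 ?_⟩
  refine abs_sub_lt_of_mem_uIcc hy h2 ?_
  simpa using (abs_nonneg _).trans_lt h2

theorem Reach.of_openSeg {J F : Set (ℝ × ℝ)} {p z : ℝ × ℝ} (hz : z ∈ openSeg J p)
    (hF : Disjoint (openSeg J p) F) : Reach F p z := by
  refine Reach.of_vertical hz.1.symm (hF.mono_left fun w hw => ?_)
  have h := mem_openSeg_iff.1 hz
  have hw' := (mem_segment_of_fst_eq h.1.symm).1 hw
  exact mem_openSeg_iff.2 ⟨hw'.1, fun y hy => h.2 y (uIcc_subset_uIcc_left hw'.2 hy)⟩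

/-- A sweep is a comb: go vertically to `t`, along `t`, and vertically again. -/
theorem Reach.of_sweepRegion {J F : Set (ℝ × ℝ)} {t : HSeg} (ht : Disjoint t.interior J)
    (hF : Disjoint (sweepRegion J t) F) {z w : ℝ × ℝ} (hz : z ∈ sweepRegion J t)
    (hw : w ∈ sweepRegion J t) : Reach F z w := by
  obtain ⟨p, hp, hpJ, hzp⟩ := mem_sweepRegion_iff.1 hz
  obtain ⟨q, hq, hqJ, hwq⟩ := mem_sweepRegion_iff.1 hw
  have sub : ∀ {p}, p ∈ t.carrier → p ∉ J → openSeg J p ⊆ sweepRegion J t := fun hp hpJ z hz =>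
    mem_sweepRegion_iff.2 ⟨_, hp, hpJ, hz⟩
  have hpq : Reach F p q := by
    refine Reach.of_horizontal ?_ (hF.mono_left fun u hu => ?_)
    · exact (HSeg.mem_carrier_iff.1 hp).2.trans (HSeg.mem_carrier_iff.1 hq).2.symm
    · exact mem_sweepRegion_of_mem ((convex_segment t.src t.tgt).segment_subset hp hq hu)
        (Set.disjoint_left.1 (HSeg.disjoint_segment ht hp hq hpJ hqJ) hu)
  exact ((Reach.of_openSeg hzp (hF.mono_left (sub hp hpJ))).symm.trans hpq).trans
    (Reach.of_openSeg hwq (hF.mono_left (sub hq hqJ)))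

/-! ### Incidence of sweeps and cross-cuts -/

namespace SweepRay

variable {J : Set (ℝ × ℝ)} (D : SweepRay J)

/-- Points near an interior point of `T k` project vertically to `T k` without meeting `J`, so they
are swept. Such a point is interior to `E n`, whereas `v n` lies on its frontier. -/
theorem disjoint_T_interior (hJ : IsClosed J) {k n : ℕ} (hkn : k ≤ n) :
    Disjoint (D.T k).interior (D.v n).interior := by
  rw [Set.disjoint_left]
  intro p hp hpv
  obtain ⟨ρ, hρ, hsq⟩ := exists_square hJ ((D.crosscut n).notMem hpv)
  have hp' := HSeg.mem_interior_iff_fst.1 hp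
  refine (D.frontier_E n hpv).2 ?_
  refine mem_interior_iff_mem_nhds.2 ?_
  have h1 : ∀ᶠ z : ℝ × ℝ in 𝓝 p,
      z.1 ∈ Ioo (min (D.T k).src.1 (D.T k).tgt.1) (max (D.T k).src.1 (D.T k).tgt.1) :=
    continuous_fst.continuousAt.eventually (isOpen_Ioo.mem_nhds hp'.2)
  filter_upwards [h1, Metric.ball_mem_nhds p hρ] with z hz hzb
  rw [Metric.mem_ball, Prod.dist_eq, max_lt_iff, Real.dist_eq, Real.dist_eq] at hzb
  have hproj := proj_mem_openSeg hsq hzb.1 hzb.2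
  have hmem : (z.1, p.2) ∈ (D.T k).interior := HSeg.mem_interior_iff_fst.2 ⟨hp'.1, hz⟩
  refine D.subset_E k n hkn (mem_sweepRegion_iff.2 ⟨(z.1, p.2), HSeg.interior_subset_carrier _ hmem,
    Set.disjoint_left.1 (D.disjoint_interior k) hmem, ?_⟩)
  rw [mem_openSeg_iff] at hproj ⊢
  exact ⟨rfl, fun y hy => hproj.2 y (uIcc_comm z.2 p.2 ▸ hy)⟩

theorem src_succ_mem (n : ℕ) : (D.T (n + 1)).src ∈ (D.v n).interior :=
  D.src_succ n ▸ (D.crosscut n).midpoint_mem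

theorem eq_src_of_mem (hJ : IsClosed J) {k n : ℕ} (hkn : k ≤ n) {p : ℝ × ℝ}
    (hp : p ∈ (D.T k).carrier) (hpv : p ∈ (D.v n).interior) : ∃ l, k = l + 1 ∧ D.v l = D.v n := by
  have hpJ := (D.crosscut n).notMem hpv
  have hsrc : p = (D.T k).src := by
    by_contra hne
    refine Set.disjoint_left.1 (D.disjoint_T_interior hJ hkn)
      (HSeg.mem_interior_iff.2 ⟨hp, hne, ?_⟩) hpv
    rintro rfl
    exact hpJ (D.tgt_mem k)
  subst hsrc
  cases k with
  | zero => exact absurd D.src_zero hpJ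
  | succ l => exact ⟨l, rfl, (D.crosscut l).eq_of_mem (D.crosscut n) (D.src_succ_mem l) hpv⟩

theorem disjoint_sweepRegion_of_carrier {k n : ℕ}
    (h : Disjoint (D.T k).carrier (D.v n).interior) :
    Disjoint (sweepRegion J (D.T k)) (D.v n).interior := by
  rw [Set.disjoint_left]
  intro z hz hzv
  obtain ⟨p, hp, -, hzp⟩ := mem_sweepRegion_iff.1 hz
  exact Set.disjoint_left.1 h hp ((D.crosscut n).mem_of_openSeg hzp hzv)

/-- Near the midpoint of `v n` the sweep `H(T n)` covers some vertical line, and that line does not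
meet `T (n + 1)`. -/
theorem exists_mem_sweepRegion (hJ : IsClosed J) {n : ℕ}
    (hd : Disjoint (D.T n).carrier (D.v n).interior) {ρ : ℝ} (hρ : 0 < ρ) :
    ∃ a, ((D.v n).x + a, (D.v n).midpoint.2) ∈ sweepRegion J (D.T n) ∧ |a| < ρ ∧
      a * ((D.T (n + 1)).tgt.1 - (D.v n).x) < 0 ∧
      Disjoint (segment ℝ ((D.v n).x + a, (D.v n).midpoint.2) (D.v n).midpoint) J := by
  set m := (D.v n).midpoint with hm
  have hmx : m.1 = (D.v n).x := rfl
  have hmv : m ∈ (D.v n).interior := (D.crosscut n).midpoint_mem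
  obtain ⟨ρ', hρ', hsq⟩ := exists_square hJ ((D.crosscut n).notMem hmv)
  have hsrc : (D.T (n + 1)).src = m := D.src_succ n
  have hne := (D.T (n + 1)).fst_ne
  rw [hsrc] at hne
  -- The third bound makes the projection of `w` fall on `T (n + 1)` if it is on the same side;
  -- `exterior` forbids that, since the projection is swept by `T n`.
  obtain ⟨w, hw, hw1, hw2⟩ := exists_mem_of_mem_closure (D.frontier_T n hmv).1
    (lt_min (lt_min hρ hρ') (abs_pos.2 hne))
  simp only [lt_min_iff] at hw1 hw2
  have hproj := mem_sweepRegion_of_openSeg hw (proj_mem_openSeg hsq hw1.1.2 hw2.1.2)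
  have hwx : w.1 - m.1 ≠ 0 := by
    intro h0
    have : (w.1, m.2) = m := Prod.ext (by simp only; linarith) rfl
    rw [this] at hproj
    exact Set.disjoint_left.1 (D.disjoint_sweepRegion_of_carrier hd) hproj hmv
  refine ⟨w.1 - m.1, ?_, hw1.1.1, ?_, ?_⟩
  · rw [← hmx, add_sub_cancel]
    exact hproj
  · rw [← hmx]
    by_contra hc
    have hpos : 0 < (w.1 - m.1) * ((D.T (n + 1)).tgt.1 - m.1) :=
      lt_of_le_of_ne (not_lt.1 hc) (mul_ne_zero hwx hne).symm
    have hint : (w.1, m.2) ∈ (D.T (n + 1)).interior := by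
      apply HSeg.mem_interior_of_mul_pos <;> rw [hsrc]
      · exact hpos
      · exact hw1.2
    have h' := HSeg.mem_interior_iff.1 hint
    refine D.exterior n ⟨h'.1, fun h => h'.2.1 ?_⟩ (subset_closure (D.subset_E n n le_rfl hproj))
    rw [hsrc]
    exact h
  · rw [Set.disjoint_left]
    intro z hz
    rw [← hmx, add_sub_cancel, mem_segment_of_snd_eq (by rfl)] at hz
    refine hsq z (abs_sub_lt_of_mem_uIcc hz.1 hw1.1.2 (by simpa using hρ')) ?_
    rw [hz.2]
    simpa using hρ'

/-- If the two agreed, `T (n + 1)` would start at the midpoint of `v l`. Close to it, one side has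
points swept by `T l`, the other is swept by `T (l + 1)`; both lie in `E n`, so `T (n + 1)` could
not leave. The induction ensures that `T l` does not itself meet `v l`. -/
theorem v_ne_of_lt (hJ : IsClosed J) : ∀ l n : ℕ, l < n → D.v l ≠ D.v n := by
  intro l
  induction l using Nat.strong_induction_on with
  | _ l ih =>
  intro n hln heq
  have hd : Disjoint (D.T l).carrier (D.v l).interior := by
    rw [Set.disjoint_left]
    intro p hp hpv
    obtain ⟨j, hj, hjl⟩ := D.eq_src_of_mem hJ le_rfl hp hpv
    exact ih j (by omega) l (by omega) hjl
  set m := (D.v l).midpoint with hm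
  have hmx : m.1 = (D.v l).x := rfl
  have hsl : (D.T (l + 1)).src = m := D.src_succ l
  have hsn : (D.T (n + 1)).src = m := by rw [D.src_succ n, ← heq]
  have hnel := (D.T (l + 1)).fst_ne
  have hnen := (D.T (n + 1)).fst_ne
  rw [hsl] at hnel
  rw [hsn] at hnen
  obtain ⟨a, ha, habs, hneg, -⟩ := D.exists_mem_sweepRegion hJ hd
    (lt_min (abs_pos.2 hnel) (abs_pos.2 hnen))
  rw [← hmx] at ha hneg
  rw [← hm] at ha
  have ha0 : a ≠ 0 := by
    rintro rfl
    simp at hneg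
  rw [lt_min_iff] at habs
  have contra : ∀ z : ℝ × ℝ, z ∈ E D n → z ∉ (D.T (n + 1)).interior := by
    intro z hz hzi
    have h' := HSeg.mem_interior_iff.1 hzi
    refine D.exterior n ⟨h'.1, fun h => h'.2.1 ?_⟩ (subset_closure hz)
    rw [D.src_succ n]
    exact h
  -- In the first case `T (n + 1)` shares the side of `T (l + 1)`, and the reflected point at offset
  -- `-a` lies on both.
  rcases lt_or_gt_of_ne (mul_ne_zero ha0 hnen) with hs | hs
  · have h1 : (m.1 + -a, m.2) ∈ (D.T (l + 1)).interior := by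
      apply HSeg.mem_interior_of_mul_pos <;> rw [hsl] <;> simp only [add_sub_cancel_left]
      · linarith
      · rw [abs_neg]; exact habs.1
    have h2 : (m.1 + -a, m.2) ∈ (D.T (n + 1)).interior := by
      apply HSeg.mem_interior_of_mul_pos <;> rw [hsn] <;> simp only [add_sub_cancel_left]
      · linarith
      · rw [abs_neg]; exact habs.2
    refine contra _ (D.subset_E (l + 1) n hln (mem_sweepRegion_of_mem
      (HSeg.interior_subset_carrier _ h1) ?_)) h2
    exact Set.disjoint_left.1 (D.disjoint_interior _) h1
  · refine contra _ (D.subset_E l n hln.le ha) ?_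
    apply HSeg.mem_interior_of_mul_pos <;> rw [hsn] <;> simp only [add_sub_cancel_left]
    · exact hs
    · exact habs.2

theorem v_injective (hJ : IsClosed J) : Function.Injective D.v := by
  intro a b hab
  rcases lt_trichotomy a b with h | h | h
  · exact absurd hab (D.v_ne_of_lt hJ a b h)
  · exact h
  · exact absurd hab.symm (D.v_ne_of_lt hJ b a h)

theorem v_interior_subset (n : ℕ) : (D.v n).interior ⊆ sweepRegion J (D.T (n + 1)) := fun _ hz =>
  mem_sweepRegion_iff.2 ⟨_, HSeg.src_mem_carrier _, (D.crosscut n).notMem (D.src_succ_mem n),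
    (D.crosscut n).mem_openSeg (D.src_succ_mem n) hz⟩

/-- Up to index `n` only the source of `T k` could lie on `v n`, which distinctness excludes. Beyond
`n + 1`, `v n` is already swept, and `T k` avoids the swept region except at its source. -/
theorem disjoint_carrier (hJ : IsClosed J) {k n : ℕ} (hkn : k ≠ n + 1) :
    Disjoint (D.T k).carrier (D.v n).interior := by
  rw [Set.disjoint_left]
  intro p hp hpv
  rcases le_or_gt k n with h | h
  · obtain ⟨l, hl, hv⟩ := D.eq_src_of_mem hJ h hp hpv
    have := D.v_injective hJ hv
    omega
  · obtain ⟨l, rfl⟩ : ∃ l, k = l + 1 := ⟨k - 1, by omega⟩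
    by_cases hps : p = (D.v l).midpoint
    · subst hps
      have := D.v_injective hJ
        ((D.crosscut l).eq_of_mem (D.crosscut n) (D.crosscut l).midpoint_mem hpv)
      omega
    · exact D.exterior l ⟨hp, hps⟩
        (subset_closure (D.subset_E (n + 1) l (by omega) (D.v_interior_subset n hpv)))

theorem disjoint_sweepRegion_union (hJ : IsClosed J) {k n : ℕ} (hkn : k ≠ n + 1) :
    Disjoint (sweepRegion J (D.T k)) (J ∪ (D.v n).interior) :=
  disjoint_union_right.2 ⟨disjoint_sweepRegion,
    D.disjoint_sweepRegion_of_carrier (D.disjoint_carrier hJ hkn)⟩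

/-! ### Separation of earlier from later sweeps -/

/-- Consecutive sweeps of the ray are joined off `J` and off every other vertical segment. -/
theorem exists_reach_midpoint (hJ : IsClosed J) {l n : ℕ} (hln : l ≠ n) :
    ∃ w ∈ sweepRegion J (D.T l), w ∉ (D.v n).interior ∧
      Reach (J ∪ (D.v n).interior) w (D.v l).midpoint := by
  have hmv := (D.crosscut l).midpoint_mem
  have hmF : (D.v l).midpoint ∉ J ∪ (D.v n).interior := by
    rintro (h | h)
    · exact (D.crosscut l).notMem hmv h
    · exact hln (D.v_injective hJ ((D.crosscut l).eq_of_mem (D.crosscut n) hmv h))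
  obtain ⟨ρ, hρ, hsq⟩ := exists_square ((D.crosscut n).isClosed_union hJ) hmF
  obtain ⟨w, hw, hw1, hw2⟩ := exists_mem_of_mem_closure (D.frontier_T l hmv).1 hρ
  have h0 : ∀ c : ℝ, |c - c| < ρ := fun c => by simpa using hρ
  refine ⟨w, hw, fun h => hsq w hw1 hw2 (Or.inr h), ?_⟩
  refine Reach.trans (q := (w.1, (D.v l).midpoint.2)) (Reach.of_vertical (by rfl) ?_)
    (Reach.of_horizontal (by rfl) ?_)
  · rw [Set.disjoint_left]
    intro z hz
    rw [mem_segment_of_fst_eq (by rfl)] at hz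
    exact hsq z (hz.1 ▸ hw1) (abs_sub_lt_of_mem_uIcc hz.2 hw2 (h0 _))
  · rw [Set.disjoint_left]
    intro z hz
    rw [mem_segment_of_snd_eq (by rfl)] at hz
    exact hsq z (abs_sub_lt_of_mem_uIcc hz.1 hw1 (h0 _)) (hz.2 ▸ h0 _)

/-- `T (n + 1)` touches `v n` only at its source, and each later sweep is entered across some `v l`
with `l ≠ n`. So all later sweeps lie on one side of `v n`. -/
theorem reach_of_lt (hJ : IsClosed J) {n : ℕ} {q : ℝ × ℝ} (hq : q ∈ (D.T (n + 1)).interior)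
    {l : ℕ} (hl : n + 1 ≤ l) : ∀ z ∈ sweepRegion J (D.T l), z ∉ (D.v n).interior →
      Reach (J ∪ (D.v n).interior) q z := by
  induction l, hl using Nat.le_induction with
  | base =>
    intro z hz hzv
    obtain ⟨p, hp, hpJ, hzp⟩ := mem_sweepRegion_iff.1 hz
    have hpv : p ∉ (D.v n).interior := fun hpv =>
      hzv ((D.crosscut n).mem_of_openSeg ((mem_openSeg_iff.2 ?_) : p ∈ openSeg J z) hpv)
    · have hq' := HSeg.mem_interior_iff.1 hq
      have hqJ := Set.disjoint_left.1 (D.disjoint_interior _) hq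
      have hps : p ≠ (D.T (n + 1)).src := fun h => hpv (h ▸ D.src_succ_mem n)
      have hpi : p ∈ (D.T (n + 1)).interior :=
        HSeg.mem_interior_iff.2 ⟨hp, hps, fun h => hpJ (h ▸ D.tgt_mem _)⟩
      refine (Reach.of_horizontal ?_ (Set.disjoint_left.2 ?_)).trans
        (Reach.of_openSeg hzp (disjoint_union_right.2 ⟨disjoint_openSeg p, ?_⟩))
      · exact (HSeg.mem_carrier_iff.1 hq'.1).2.trans (HSeg.mem_carrier_iff.1 hp).2.symm
      · have hconv : Convex ℝ (D.T (n + 1)).interior := convex_openSegment _ _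
        intro u hu
        have hui := hconv.segment_subset hq hpi hu
        have hu' := HSeg.mem_interior_iff.1 hui
        rintro (h | h)
        · exact Set.disjoint_left.1 (D.disjoint_interior _) hui h
        · refine hu'.2.1 (Prod.ext ?_ (HSeg.mem_carrier_iff.1 hu'.1).2)
          rw [(VSeg.mem_interior_iff.1 h).1, D.src_succ n]
          rfl
      · exact Set.disjoint_left.2 fun u hu huv => hpv ((D.crosscut n).mem_of_openSeg hu huv)
    · have h := mem_openSeg_iff.1 hzp
      exact ⟨h.1.symm, fun y hy => h.1 ▸ h.2 y (uIcc_comm z.2 p.2 ▸ hy)⟩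
  | succ l hl ih =>
    intro z hz hzv
    obtain ⟨w, hw, hwv, hr⟩ := D.exists_reach_midpoint hJ (l := l) (n := n) (by omega)
    exact ((ih w hw hwv).trans hr).trans (Reach.of_sweepRegion (D.disjoint_interior _)
      (D.disjoint_sweepRegion_union hJ (by omega))
      (D.v_interior_subset l (D.crosscut l).midpoint_mem) hz)

/-- A point on the horizontal line through the midpoint of `v n`, on the side away from `T (n + 1)`,
cannot be joined to the later sweeps. -/
theorem not_reach_of_opposite (hJ : IsClosed J) (hJc : IsPreconnected J) {n l : ℕ} (hl : n < l)
    {a : ℝ} (ha : a * ((D.T (n + 1)).tgt.1 - (D.v n).x) < 0)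
    (hd : Disjoint (segment ℝ ((D.v n).x + a, (D.v n).midpoint.2) (D.v n).midpoint) J)
    {z : ℝ × ℝ} (hz : z ∈ sweepRegion J (D.T l)) (hzv : z ∉ (D.v n).interior) :
    ¬ Reach (J ∪ (D.v n).interior) ((D.v n).x + a, (D.v n).midpoint.2) z := by
  intro hr
  have hsrc := D.src_succ n
  have hmx : (D.v n).midpoint.1 = (D.v n).x := rfl
  have hmv := VSeg.mem_interior_iff.1 (D.crosscut n).midpoint_mem
  set m := (D.v n).midpoint
  set d := (D.T (n + 1)).tgt.1 - (D.v n).x with hdd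
  have hd0 : d ≠ 0 := by
    intro h0
    rw [h0] at ha
    simp at ha
  -- The midpoint of `T (n + 1)` represents the far side of `v n`: it reaches all later sweeps, and
  -- its horizontal link to the given point crosses `v n`.
  have hqi : (m.1 + d / 2, m.2) ∈ (D.T (n + 1)).interior := by
    apply HSeg.mem_interior_of_mul_pos <;> rw [hsrc] <;> simp only [add_sub_cancel_left] <;>
      rw [hmx, ← hdd]
    · have := mul_self_pos.2 hd0
      linarith
    · rw [abs_div, abs_two]
      linarith [abs_pos.2 hd0]
  have hrq := D.reach_of_lt hJ hqi hl z hz hzv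
  refine (D.crosscut n).not_reach hJc (p := ((D.v n).x + a, m.2))
    (q := (m.1 + d / 2, m.2)) rfl ?_ hmv.2.1 hmv.2.2 ?_
    (hr.trans hrq.symm)
  · have hd2 : Disjoint (segment ℝ m (m.1 + d / 2, m.2)) J := by
      refine HSeg.disjoint_segment (D.disjoint_interior (n + 1)) ?_
        (HSeg.interior_subset_carrier _ hqi) ((D.crosscut n).notMem (D.crosscut n).midpoint_mem)
        (Set.disjoint_left.1 (D.disjoint_interior _) hqi)
      exact hsrc ▸ HSeg.src_mem_carrier _
    rw [Set.disjoint_left]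
    intro u hu
    rw [mem_segment_of_snd_eq (by rfl)] at hu
    rcases uIcc_subset_uIcc_union_uIcc (b := m.1) hu.1 with h | h
    · exact Set.disjoint_left.1 hd ((mem_segment_of_snd_eq (by rfl)).2 ⟨h, hu.2⟩)
    · exact Set.disjoint_left.1 hd2 ((mem_segment_of_snd_eq (by rfl)).2 ⟨h, hu.2⟩)
  · simp only [hmx, add_sub_cancel_left]
    linarith

/-- The vertical segment `v n` separates the sweeps up to `T n` from the later ones. -/
theorem not_reach (hJ : IsClosed J) (hJc : IsPreconnected J) {k n l : ℕ} (hk : k ≤ n) (hl : n < l)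
    {z w : ℝ × ℝ} (hz : z ∈ sweepRegion J (D.T k)) (hw : w ∈ sweepRegion J (D.T l))
    (hwv : w ∉ (D.v n).interior) : ¬ Reach (J ∪ (D.v n).interior) z w := by
  obtain ⟨a, hmem, -, hneg, hdis⟩ := D.exists_mem_sweepRegion hJ
    (D.disjoint_carrier hJ (Nat.ne_of_lt n.lt_succ_self)) zero_lt_one
  -- Induction on the distance `j` from `T k` to `T n` follows the chain of sweeps forward to the
  -- point beside `v n`.
  have hreach : ∀ j k, k + j = n → ∀ z ∈ sweepRegion J (D.T k),
      Reach (J ∪ (D.v n).interior) z ((D.v n).x + a, (D.v n).midpoint.2) := by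
    intro j
    induction j with
    | zero =>
      rintro k rfl z hz
      exact Reach.of_sweepRegion (D.disjoint_interior _)
        (D.disjoint_sweepRegion_union hJ (by omega)) hz hmem
    | succ j ih =>
      intro k hk z hz
      obtain ⟨u, hu, -, hr⟩ := D.exists_reach_midpoint hJ (l := k) (n := n) (by omega)
      exact ((Reach.of_sweepRegion (D.disjoint_interior _)
        (D.disjoint_sweepRegion_union hJ (by omega)) hz hu).trans hr).trans
        (ih (k + 1) (by omega) _ (D.v_interior_subset k (D.crosscut k).midpoint_mem))
  exact fun h => D.not_reach_of_opposite hJ hJc hl hneg hdis hw hwv 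
    ((hreach (n - k) k (by omega) z hz).symm.trans h)

end SweepRay

/-! ### One-sided accumulation -/

/-- If cross-cuts converge from one side to a vertical segment of positive length, then near each
interior point of the limit there is no point of `J` on that side. The sign `ε` tells the side. -/
theorem exists_half_square {g : ℝ → ℝ × ℝ} (hg : Continuous g) {a b : ℝ}
    (hrange : range g = g '' Icc a b) {σ : ℕ → VSeg} (hσ : ∀ k, IsCrosscut (range g) (σ k))
    {x lo hi ε y : ℝ} (hε : ε = 1 ∨ ε = -1) (hside : ∀ k, 0 < ε * (x - (σ k).x))
    (hx : Tendsto (fun k => (σ k).x) atTop (𝓝 x))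
    (hlo : Tendsto (fun k => (σ k).lo) atTop (𝓝 lo))
    (hhi : Tendsto (fun k => (σ k).hi) atTop (𝓝 hi)) (hy1 : lo < y) (hy2 : y < hi) :
    ∃ δ > 0, ∀ z : ℝ × ℝ, |z.1 - x| < δ → |z.2 - y| < δ → 0 < ε * (x - z.1) →
      z ∉ range g := by
  by_contra! hcon
  -- Otherwise points of `J` on that side converge to `(x, y)`, and compactness makes their
  -- parameters accumulate at some `θ₀`.
  have hseq : ∀ j : ℕ, ∃ θ ∈ Icc a b, |(g θ).1 - x| < 1 / ((j : ℝ) + 1) ∧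
      |(g θ).2 - y| < 1 / ((j : ℝ) + 1) ∧ 0 < ε * (x - (g θ).1) := by
    intro j
    obtain ⟨z, h1, h2, h3, hz⟩ := hcon (1 / ((j : ℝ) + 1)) (by positivity)
    rw [hrange] at hz
    obtain ⟨θ, hθ, rfl⟩ := hz
    exact ⟨θ, hθ, h1, h2, h3⟩
  choose θ hθ h1 h2 h3 using hseq
  obtain ⟨θ₀, -, ψ, hψ, hlim⟩ := isCompact_Icc.tendsto_subseq hθ
  have hone : Tendsto (fun j => 1 / ((ψ j : ℝ) + 1)) atTop (𝓝 0) :=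
    (tendsto_one_div_add_atTop_nhds_zero_nat (𝕜 := ℝ)).comp hψ.tendsto_atTop
  have hgl : Tendsto (fun j => g (θ (ψ j))) atTop (𝓝 (g θ₀)) := (hg.tendsto θ₀).comp hlim
  have hconv : ∀ {f : ℕ → ℝ} {c d : ℝ}, (∀ j, |f j - c| < 1 / ((ψ j : ℝ) + 1)) →
      Tendsto f atTop (𝓝 d) → d = c := fun {f c d} hf hd => by
    refine tendsto_nhds_unique hd (tendsto_iff_dist_tendsto_zero.2 ?_)
    exact squeeze_zero (fun _ => dist_nonneg) (fun j => (hf j).le) hone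
  have hx0 : (g θ₀).1 = x := hconv (fun j => h1 (ψ j)) ((continuous_fst.tendsto _).comp hgl)
  have hy0 : (g θ₀).2 = y := hconv (fun j => h2 (ψ j)) ((continuous_snd.tendsto _).comp hgl)
  obtain ⟨lo', hlo1, hlo2⟩ := exists_between hy1
  obtain ⟨hi', hhi1, hhi2⟩ := exists_between hy2
  have hU : ∀ᶠ s in 𝓝 θ₀, (g s).2 ∈ Ioo lo' hi' := by
    refine (continuous_snd.comp hg).continuousAt.eventually (isOpen_Ioo.mem_nhds ?_)
    simp only [Function.comp, hy0]
    exact ⟨hlo2, hhi1⟩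
  obtain ⟨r, hr, hball⟩ := Metric.eventually_nhds_iff_ball.1 hU
  obtain ⟨j, hj⟩ := (hlim.eventually (Metric.ball_mem_nhds θ₀ hr)).exists
  have hpre : IsPreconnected ((fun s => (g s).1) '' Metric.ball θ₀ r) :=
    (convex_ball θ₀ r).isPreconnected.image _ (by fun_prop)
  have hlt : ∀ᶠ k in atTop, ε * (x - (σ k).x) < ε * (x - (g (θ (ψ j))).1) := by
    have : Tendsto (fun k => ε * (x - (σ k).x)) atTop (𝓝 (ε * (x - x))) :=
      (tendsto_const_nhds.sub hx).const_mul ε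
    rw [sub_self, mul_zero] at this
    exact this.eventually_lt_const (h3 (ψ j))
  obtain ⟨k, hk1, hk2, hk3⟩ := (hlt.and ((hlo.eventually_lt_const hlo1).and
    (hhi.eventually_const_lt hhi2))).exists
  -- The arc from `g (θ (ψ j))` to `g θ₀` stays at heights strictly inside `σ k`, and by the
  -- intermediate value theorem it crosses the vertical line of `σ k`, hence `σ k` itself.
  have hmem : (σ k).x ∈ (fun s => (g s).1) '' Metric.ball θ₀ r := by
    have hj' : (g (θ (ψ j))).1 ∈ (fun s => (g s).1) '' Metric.ball θ₀ r :=
      mem_image_of_mem _ hj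
    have h0' : x ∈ (fun s => (g s).1) '' Metric.ball θ₀ r :=
      ⟨θ₀, Metric.mem_ball_self hr, hx0⟩
    have hs := hside k
    rcases hε with rfl | rfl
    · exact hpre.ordConnected.out hj' h0' ⟨by linarith, by linarith⟩
    · exact hpre.ordConnected.out h0' hj' ⟨by linarith, by linarith⟩
  obtain ⟨s, hs, hsx⟩ := hmem
  have hs2 := hball s hs
  exact (hσ k).notMem (VSeg.mem_interior_iff.2 ⟨hsx, hk2.trans hs2.1, hs2.2.trans hk3⟩)
    (mem_range_self s)

/-- A subsequence of a convergent sequence that is not eventually constant approaches the limit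
from one side. -/
theorem exists_one_sided_subseq {f : ℕ → ℝ} {x : ℝ} (h : ¬ ∀ᶠ k in atTop, f k = x) :
    ∃ ε : ℝ, (ε = 1 ∨ ε = -1) ∧ ∃ ψ : ℕ → ℕ, StrictMono ψ ∧ ∀ k, 0 < ε * (x - f (ψ k)) := by
  have h' : ∃ᶠ k in atTop, f k < x ∨ x < f k := by
    refine fun hc => h ?_
    filter_upwards [hc] with k hk
    push Not at hk
    exact le_antisymm hk.2 hk.1
  rcases frequently_or_distrib.1 h' with h | h
  · obtain ⟨ψ, hψ, hk⟩ := extraction_of_frequently_atTop h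
    exact ⟨1, Or.inl rfl, ψ, hψ, fun k => by linarith [hk k]⟩
  · obtain ⟨ψ, hψ, hk⟩ := extraction_of_frequently_atTop h
    exact ⟨-1, Or.inr rfl, ψ, hψ, fun k => by linarith [hk k]⟩

/-- In a half square off `J`, a cross-cut that meets the half square spans its height. -/
theorem IsCrosscut.mem_of_half_square {J : Set (ℝ × ℝ)} {v : VSeg} (hv : IsCrosscut J v)
    {x y δ ε : ℝ} (hsq : ∀ z : ℝ × ℝ, |z.1 - x| < δ → |z.2 - y| < δ → 0 < ε * (x - z.1) → z ∉ J)
    (hx : |v.x - x| < δ) (hs : 0 < ε * (x - v.x)) {y₁ y₂ : ℝ} (h1 : |y₁ - y| < δ)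
    (h2 : |y₂ - y| < δ) (hm : (v.x, y₁) ∈ v.interior) : (v.x, y₂) ∈ v.interior := by
  rw [VSeg.mem_interior_iff] at hm ⊢
  simp only [true_and] at hm ⊢
  constructor <;> by_contra hc
  · refine hsq (v.x, v.lo) hx ?_ hs hv.lo_mem
    exact abs_sub_lt_of_mem_uIcc (mem_uIcc.2 (Or.inr ⟨not_lt.1 hc, hm.1.le⟩)) h1 h2
  · refine hsq (v.x, v.hi) hx ?_ hs hv.hi_mem
    exact abs_sub_lt_of_mem_uIcc (mem_uIcc.2 (Or.inl ⟨hm.2.le, not_lt.1 hc⟩)) h1 h2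

theorem mul_sub_pos_of_mem_uIcc {a b c x ε : ℝ} (hc : c ∈ uIcc a b) (ha : 0 < ε * (x - a))
    (hb : 0 < ε * (x - b)) : 0 < ε * (x - c) := by
  have hconv : Convex ℝ {t : ℝ | 0 < ε * (x - t)} := by
    have : {t : ℝ | 0 < ε * (x - t)} = {t : ℝ | ε * t < ε * x} := by
      ext t
      simp only [mem_ofPred_eq]
      constructor <;> intro h <;> linarith
    rw [this]
    exact convex_halfSpace_lt (IsLinearMap.isLinearMap_smul ε) _
  rw [← segment_eq_uIcc] at hc
  exact hconv.segment_subset ha hb hc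

namespace SweepRay

/-- The vertical segments of a ray cannot accumulate from one side on a vertical segment of
positive length: the horizontal segment that starts at the midpoint of one of them would run
through all the later ones. -/
theorem false_of_tendsto {g : ℝ → ℝ × ℝ} (hg : Continuous g) {a b : ℝ}
    (hrange : range g = g '' Icc a b) (D : SweepRay (range g)) {ψ : ℕ → ℕ} (hψ : StrictMono ψ)
    {x lo hi ε : ℝ} (hε : ε = 1 ∨ ε = -1) (hside : ∀ k, 0 < ε * (x - (D.v (ψ k)).x))
    (hx : Tendsto (fun k => (D.v (ψ k)).x) atTop (𝓝 x))
    (hlo : Tendsto (fun k => (D.v (ψ k)).lo) atTop (𝓝 lo))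
    (hhi : Tendsto (fun k => (D.v (ψ k)).hi) atTop (𝓝 hi)) (hlt : lo < hi) : False := by
  have hJ : IsClosed (range g) := by
    rw [hrange]
    exact (isCompact_Icc.image hg).isClosed
  obtain ⟨δ, hδ, hsq⟩ := exists_half_square hg hrange (fun k => D.crosscut (ψ k)) hε hside hx hlo
    hhi (y := (lo + hi) / 2) (by linarith) (by linarith)
  set y := (lo + hi) / 2
  have hmid : Tendsto (fun k => (D.v (ψ k)).midpoint.2) atTop (𝓝 y) :=
    (hlo.add hhi).div_const 2
  have near : ∀ᶠ k in atTop, |(D.v (ψ k)).x - x| < δ ∧ |(D.v (ψ k)).midpoint.2 - y| < δ :=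
    (hx.eventually (Metric.ball_mem_nhds x hδ)).and (hmid.eventually (Metric.ball_mem_nhds y hδ))
  obtain ⟨i, hi1, hi2⟩ := near.exists
  have hcl : ∀ᶠ k in atTop, ε * (x - (D.v (ψ k)).x) < ε * (x - (D.v (ψ i)).x) := by
    have : Tendsto (fun k => ε * (x - (D.v (ψ k)).x)) atTop (𝓝 (ε * (x - x))) :=
      (tendsto_const_nhds.sub hx).const_mul ε
    rw [sub_self, mul_zero] at this
    exact this.eventually_lt_const (hside i)
  obtain ⟨j, ⟨hj1, hj2⟩, hj3, hij⟩ := (near.and (hcl.and (eventually_gt_atTop i))).exists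
  have hsi := hside i
  have hsj := hside j
  have hnn : ψ i < ψ j := hψ hij
  generalize ψ i = n at *
  generalize ψ j = n' at *
  set m := (D.v n).midpoint with hm
  have hmx : m.1 = (D.v n).x := rfl
  have hsrc : (D.T (n + 1)).src = m := D.src_succ n
  have hne := (D.T (n + 1)).fst_ne
  rw [hsrc] at hne
  have htgt2 : (D.T (n + 1)).tgt.2 = m.2 := by rw [← (D.T (n + 1)).horizontal, hsrc]
  have hmem : ((D.v n').x, m.2) ∈ (D.v n').interior :=
    (D.crosscut n').mem_of_half_square hsq hj1 hsj hj2 hi2 (D.crosscut n').midpoint_mem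
  have hε2 : ε * ε = 1 := by rcases hε with rfl | rfl <;> norm_num
  -- Towards the limit, `T (n + 1)` cannot end in the clear half-square, so it crosses the later `v
  -- n'`. Away from the limit, the point of `v n'` at height `m.2` is on the opposite side of `v n`,
  -- yet is swept by `T (n' + 1)`.
  rcases lt_or_ge 0 (ε * ((D.T (n + 1)).tgt.1 - (D.v n).x)) with hpos | hneg
  · have htx : ε * (x - (D.T (n + 1)).tgt.1) ≤ 0 := by
      by_contra hc
      push Not at hc
      refine hsq _ ?_ (htgt2 ▸ hi2) hc (D.tgt_mem (n + 1))
      rw [abs_lt] at hi1 ⊢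
      rcases hε with rfl | rfl <;> constructor <;> linarith
    refine Set.disjoint_left.1 (D.disjoint_T_interior hJ hnn) ?_ hmem
    rw [HSeg.mem_interior_iff_fst, hsrc]
    refine ⟨rfl, ?_⟩
    simp only [mem_Ioo, min_lt_iff, lt_max_iff, hmx]
    rcases hε with rfl | rfl
    · exact ⟨Or.inl (by linarith), Or.inr (by linarith)⟩
    · exact ⟨Or.inr (by linarith), Or.inl (by linarith)⟩
  · have hneg' : ε * ((D.T (n + 1)).tgt.1 - (D.v n).x) < 0 := by
      refine lt_of_le_of_ne hneg (mul_ne_zero ?_ hne)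
      rintro rfl
      simp at hε2
    refine D.not_reach_of_opposite hJ (isPreconnected_range hg) (hnn.trans n'.lt_succ_self)
      (a := (D.v n').x - (D.v n).x) ?_ ?_ (D.v_interior_subset n' hmem) ?_ ?_
    · have : 0 < ε * ((D.v n').x - (D.v n).x) := by linarith
      have := mul_neg_of_pos_of_neg this hneg'
      rwa [mul_mul_mul_comm, hε2, one_mul] at this
    · rw [add_sub_cancel, Set.disjoint_left]
      intro z hz
      rw [mem_segment_of_snd_eq (by rfl)] at hz
      refine hsq z (abs_sub_lt_of_mem_uIcc hz.1 hj1 hi1) (hz.2 ▸ hi2) ?_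
      exact mul_sub_pos_of_mem_uIcc hz.1 hsj hsi
    · intro h
      have := (VSeg.mem_interior_iff.1 h).1
      simp only at this
      rw [this] at hj3
      exact lt_irrefl _ hj3
    · rw [add_sub_cancel]
      exact Relation.ReflTransGen.refl

/-- Open segments from the sweeps of a ray do not converge from one side to a segment of positive
length. -/
theorem false_of_sweeps {g : ℝ → ℝ × ℝ} (hg : Continuous g) {a b : ℝ}
    (hrange : range g = g '' Icc a b) (D : SweepRay (range g)) {φ : ℕ → ℕ} (hφ : StrictMono φ)
    {σ : ℕ → VSeg} (hσc : ∀ k, IsCrosscut (range g) (σ k))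
    (hσ : ∀ k, (σ k).interior ⊆ sweepRegion (range g) (D.T (φ k)))
    {x lo hi ε : ℝ} (hε : ε = 1 ∨ ε = -1) (hside : ∀ k, 0 < ε * (x - (σ k).x))
    (hx : Tendsto (fun k => (σ k).x) atTop (𝓝 x))
    (hlo : Tendsto (fun k => (σ k).lo) atTop (𝓝 lo))
    (hhi : Tendsto (fun k => (σ k).hi) atTop (𝓝 hi)) (hlt : lo < hi) : False := by
  have hJK : IsCompact (range g) := by
    rw [hrange]
    exact isCompact_Icc.image hg
  obtain ⟨δ, hδ, hsq⟩ := exists_half_square hg hrange hσc hε hside hx hlo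
    hhi (y := (lo + hi) / 2) (by linarith) (by linarith)
  set y := (lo + hi) / 2 with hy
  have hspan : ∀ᶠ k in atTop, ((σ k).x, y) ∈ (σ k).interior := by
    filter_upwards [hlo.eventually_lt_const (show lo < y by linarith),
      hhi.eventually_const_lt (show y < hi by linarith)] with k h1 h2
    exact VSeg.mem_interior_iff.2 ⟨rfl, h1, h2⟩
  have h0 : |y - y| < δ := by simpa using hδ
  have key : ∀ η > 0, η ≤ δ → ∀ᶠ n in atTop, |(D.v n).x - x| < η ∧ 0 < ε * (x - (D.v n).x) ∧
      ((D.v n).x, y) ∈ (D.v n).interior := by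
    intro η hη hηδ
    obtain ⟨K, hK⟩ := eventually_atTop.1
      (hspan.and (hx.eventually (Metric.ball_mem_nhds x hη)))
    filter_upwards [eventually_ge_atTop (φ K)] with n hn
    -- Since `φ k ≥ k > n`, the segments `σ K` and `σ k` belong to sweeps on different sides of `v
    -- n`.
    set k := max K (n + 1) with hk
    have hnk : n < φ k := lt_of_lt_of_le (lt_of_lt_of_le n.lt_succ_self (le_max_right _ _))
      hφ.le_apply
    obtain ⟨hK1, hK2⟩ := hK K le_rfl
    obtain ⟨hk1, hk2⟩ := hK k (le_max_left _ _)
    have hlink : ∀ z : ℝ × ℝ, z ∈ segment ℝ ((σ K).x, y) ((σ k).x, y) →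
        |z.1 - x| < η ∧ 0 < ε * (x - z.1) ∧ z.2 = y := by
      intro z hz
      rw [mem_segment_of_snd_eq (by rfl)] at hz
      exact ⟨abs_sub_lt_of_mem_uIcc hz.1 hK2 hk2,
        mul_sub_pos_of_mem_uIcc hz.1 (hside K) (hside k), hz.2⟩
    have hex : ∃ z ∈ segment ℝ ((σ K).x, y) ((σ k).x, y), z ∈ (D.v n).interior := by
      by_contra! hc
      refine D.not_reach hJK.isClosed (isPreconnected_range hg) hn hnk (hσ K hK1) (hσ k hk1)
        (hc _ (right_mem_segment _ _ _)) (Reach.of_horizontal rfl (Set.disjoint_left.2 ?_))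
      rintro z hz (h | h)
      · obtain ⟨e1, e2, e3⟩ := hlink z hz
        exact hsq z (e1.trans_le hηδ) (e3 ▸ h0) e2 h
      · exact hc z hz h
    obtain ⟨z, hz, hzv⟩ := hex
    obtain ⟨e1, e2, e3⟩ := hlink z hz
    have hzx : z.1 = (D.v n).x := (VSeg.mem_interior_iff.1 hzv).1
    have hze : z = ((D.v n).x, y) := Prod.ext hzx e3
    rw [hzx] at e1 e2
    exact ⟨e1, e2, hze ▸ hzv⟩
  have hvx : Tendsto (fun n => (D.v n).x) atTop (𝓝 x) := by
    rw [Metric.tendsto_nhds]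
    intro η hη
    filter_upwards [key (min η δ) (lt_min hη hδ) (min_le_right _ _)] with n hn
    exact hn.1.trans_le (min_le_left _ _)
  obtain ⟨N, hN⟩ := eventually_atTop.1 (key δ hδ le_rfl)
  -- The endpoints of the `v n` lie in the compact set `J`, so a subsequence converges. Its limit
  -- has length at least `δ`, because every late `v n` spans the half-square.
  obtain ⟨c, -, ψ, hψ, hc⟩ := (hJK.prod hJK).tendsto_subseq
    (x := fun n => (((D.v (N + n)).x, (D.v (N + n)).lo), ((D.v (N + n)).x, (D.v (N + n)).hi)))
    (fun n => ⟨(D.crosscut _).lo_mem, (D.crosscut _).hi_mem⟩)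
  have hmono : StrictMono fun n => N + ψ n := fun i j h => Nat.add_lt_add_left (hψ h) N
  have hvlo : Tendsto (fun n => (D.v (N + ψ n)).lo) atTop (𝓝 c.1.2) :=
    ((continuous_snd.comp continuous_fst).tendsto c).comp hc
  have hvhi : Tendsto (fun n => (D.v (N + ψ n)).hi) atTop (𝓝 c.2.2) :=
    ((continuous_snd.comp continuous_snd).tendsto c).comp hc
  have hspanv : ∀ n, ∀ y', |y' - y| < δ → ((D.v (N + ψ n)).x, y') ∈ (D.v (N + ψ n)).interior := by
    intro n y' hy'
    obtain ⟨e1, e2, e3⟩ := hN (N + ψ n) (Nat.le_add_right _ _)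
    exact (D.crosscut _).mem_of_half_square hsq e1 e2 h0 hy' e3
  have hδ2 : |δ / 2| < δ := by
    rw [abs_of_pos (by linarith)]
    linarith
  refine D.false_of_tendsto hg hrange hmono hε
    (fun k => (hN (N + ψ k) (Nat.le_add_right _ _)).2.1)
    (hvx.comp hmono.tendsto_atTop) hvlo hvhi ?_
  have hle1 : c.1.2 ≤ y - δ / 2 := le_of_tendsto hvlo (Eventually.of_forall fun n =>
    (VSeg.mem_interior_iff.1 (hspanv n (y - δ / 2) (by simpa using hδ2))).2.1.le)
  have hle2 : y + δ / 2 ≤ c.2.2 := ge_of_tendsto hvhi (Eventually.of_forall fun n =>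
    (VSeg.mem_interior_iff.1 (hspanv n (y + δ / 2) (by simpa using hδ2))).2.2.le)
  linarith

/-- No open segment belongs to three sweeps of a ray. -/
theorem false_of_mem_three {J : Set (ℝ × ℝ)} (hJ : IsClosed J) (D : SweepRay J) {i j k : ℕ} (hij : i < j)
    (hjk : j < k) {s : Set (ℝ × ℝ)} (hi : s ∈ sweep J (D.T i)) (hj : s ∈ sweep J (D.T j))
    (hk : s ∈ sweep J (D.T k)) : False := by
  obtain ⟨p, hp, hpJ, rfl⟩ := hi
  obtain ⟨q, hq, hqJ, hpq⟩ := hj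
  obtain ⟨r, hr, hrJ, hpr⟩ := hk
  obtain ⟨l, rfl⟩ : ∃ l, j = l + 1 := ⟨j - 1, by omega⟩
  -- `T (l + 1)` can meet a segment already swept by `T i` only at its source, so the shared segment
  -- is `v l`, which `T k` does not meet.
  have hqv : q ∈ (D.v l).interior := by
    by_cases hqm : q = (D.v l).midpoint
    · exact hqm ▸ (D.crosscut l).midpoint_mem
    · refine absurd (subset_closure (D.subset_E i l (by omega) ?_)) (D.exterior l ⟨hq, hqm⟩)
      exact mem_sweepRegion_iff.2 ⟨p, hp, hpJ, hpq ▸ mem_openSeg_self hqJ⟩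
  have hrv : r ∈ (D.v l).interior :=
    (D.crosscut l).mem_of_openSeg (hpr ▸ hpq ▸ mem_openSeg_self hqJ) hqv
  exact Set.disjoint_left.1 (D.disjoint_carrier hJ (by omega)) hr hrv

end SweepRay

/-! ### From a run to the theorem -/

/-- The data along an infinite ray of the recursion tree of a run. -/
def GreedyRun.sweepRay {J : Set (ℝ × ℝ)} {pstar : ℝ × ℝ} (R : GreedyRun J pstar)
    {r : ℕ → R.Node} (hr : R.IsRootRay r) : SweepRay J := by
  -- The step index in `IsChild` is existential and cannot be extracted as data; it is the
  -- predecessor of the child's index, so the fields are defined by subtraction.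
  have hc : ∀ n, (r (n + 1)).1 = ((r (n + 1)).1 - 1) + 1 ∧ (r n).1 ≤ (r (n + 1)).1 - 1 ∧
      R.u ((r (n + 1)).1 - 1) ∈ verticals J (frontier (sweepRegion J (R.t (r n).1))) := by
    intro n
    obtain ⟨i, h1, h2, h3⟩ := hr.2 n
    have : (r (n + 1)).1 - 1 = i := by omega
    rw [this]
    exact ⟨h1, h2, h3⟩
  have hlt : ∀ n, (((r (n + 1)).1 - 1 : ℕ) : ℕ∞) < R.steps := by
    intro n
    refine lt_of_lt_of_le ?_ (r (n + 1)).2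
    rw [Nat.cast_lt]
    have := (hc n).1
    omega
  have hmono : Monotone fun n => (r n).1 := monotone_nat_of_le_succ fun n => by
    have := hc n
    omega
  have hzero : (r 0).1 = 0 := by rw [hr.1]; rfl
  exact
  { T := fun n => R.t (r n).1
    v := fun n => R.u ((r (n + 1)).1 - 1)
    E := fun n => swept J R.t ((r (n + 1)).1 - 1)
    crosscut := fun n => ⟨(hc n).2.2.1, (hc n).2.2.2.2.1, (hc n).2.2.2.2.2.1, (hc n).2.2.2.2.2.2⟩
    frontier_E := fun n => (R.choice _ (hlt n)).2.1
    frontier_T := fun n => (hc n).2.2.2.1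
    subset_E := fun k n hkn => by
      have h1 : (r k).1 ≤ (r (n + 1)).1 - 1 := (hmono hkn).trans (hc n).2.1
      exact subset_iUnion₂_of_subset _ h1 Subset.rfl
    disjoint_interior := fun n => by
      cases n with
      | zero => rw [hzero]; exact R.first_interior
      | succ n => exact (hc n).1 ▸ R.next_interior _ (hlt n)
    tgt_mem := fun n => by
      cases n with
      | zero => rw [hzero]; exact R.first_tgt
      | succ n => exact (hc n).1 ▸ R.next_tgt _ (hlt n)
    src_zero := by rw [hzero]; exact R.first_src
    src_succ := fun n => by
      have := R.next_src _ (hlt n)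
      rwa [← (hc n).1] at this
    exterior := fun n => by
      have := R.next_exterior _ (hlt n)
      rwa [← (hc n).1] at this }

/-- A Jordan curve is the image of the line, and of a compact interval, under a continuous map. -/
theorem IsJordanCurve.exists_param {J : Set (ℝ × ℝ)} (hJ : IsJordanCurve J) :
    ∃ (g : ℝ → ℝ × ℝ) (a b : ℝ), Continuous g ∧ J = range g ∧ range g = g '' Icc a b := by
  obtain ⟨γ, hγ, -, rfl⟩ := hJ
  have himg : ∀ c : Circle, ∃ θ ∈ Icc (-Real.pi) Real.pi, Circle.exp θ = c := fun c =>
    ⟨Complex.arg c, ⟨(Complex.neg_pi_lt_arg _).le, Complex.arg_le_pi _⟩, Circle.exp_arg c⟩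
  refine ⟨fun θ => γ (Circle.exp θ), -Real.pi, Real.pi, hγ.comp Circle.exp.continuous, ?_, ?_⟩
  · refine Subset.antisymm ?_ ?_
    · rintro _ ⟨c, rfl⟩
      obtain ⟨θ, -, rfl⟩ := himg c
      exact ⟨θ, rfl⟩
    · rintro _ ⟨θ, rfl⟩
      exact mem_range_self _
  · refine Subset.antisymm ?_ (image_subset_range _ _)
    rintro _ ⟨θ, rfl⟩
    obtain ⟨θ', h, h'⟩ := himg (Circle.exp θ)
    exact ⟨θ', h, by simp only [h']⟩

end Sweep

theorem mainTheorem2 (J : Set (ℝ × ℝ)) (hJ : Sweep.IsJordanCurve J)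
    (pstar : ℝ × ℝ) (hp : pstar ∉ J)
    (hfin : ∀ s ∈ Sweep.segClass J pstar, Bornology.IsBounded s)
    (R : Sweep.GreedyRun J pstar) :
    ¬ ∃ r : ℕ → R.Node, R.IsRootRay r ∧ R.NonTerminating r := by
  rintro ⟨r, hr, s, ⟨φ, hφ, σ, hσ, hx, hlo, hhi⟩, hlen⟩
  obtain ⟨g, a, b, hg, rfl, hrange⟩ := hJ.exists_param
  have hlt : s.lo < s.hi := by
    simp only [Sweep.VSeg.length] at hlen
    linarith
  let D := R.sweepRay hr
  have hσD : ∀ k, (σ k).interior ∈ Sweep.sweep (range g) (D.T (φ k)) := hσ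
  have hσc : ∀ k, Sweep.IsCrosscut (range g) (σ k) := fun k => by
    obtain ⟨p, -, hpJ, h⟩ := hσ k
    exact Sweep.isCrosscut_of_interior_eq_openSeg hpJ h
  by_cases hconst : ∀ᶠ k in atTop, (σ k).x = s.x
  · have hclosed : IsClosed (range g) := hrange ▸ (isCompact_Icc.image hg).isClosed
    obtain ⟨y, hy1, hy2⟩ := exists_between hlt
    obtain ⟨K, hK⟩ := eventually_atTop.1 (hconst.and
      ((hlo.eventually_lt_const hy1).and (hhi.eventually_const_lt hy2)))
    have hmem : ∀ k ≥ K, (s.x, y) ∈ (σ k).interior := fun k hk =>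
      Sweep.VSeg.mem_interior_iff.2 ⟨(hK k hk).1.symm, (hK k hk).2⟩
    -- Cross-cuts on the same vertical line through a common point `(s.x, y)` coincide.
    have heq : ∀ k ≥ K, σ k = σ K := fun k hk =>
      (hσc k).eq_of_mem (hσc K) (hmem k hk) (hmem K le_rfl)
    refine D.false_of_mem_three hclosed (hφ (Nat.lt_succ_self K))
      (hφ (Nat.lt_succ_self (K + 1))) (hσD K) ?_ ?_
    · exact heq (K + 1) (by omega) ▸ hσD (K + 1)
    · exact heq (K + 2) (by omega) ▸ hσD (K + 2)
  · obtain ⟨ε, hε, ψ, hψ, hside⟩ := Sweep.exists_one_sided_subseq hconst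
    have hψt := hψ.tendsto_atTop
    exact D.false_of_sweeps hg hrange (hφ.comp hψ) (fun k => hσc (ψ k))
      (fun k => subset_sUnion_of_mem (hσD (ψ k))) hε hside (hx.comp hψt) (hlo.comp hψt)
      (hhi.comp hψt) hlt
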